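/- An ordered groupoid $G$ is a small groupoid internal to the category of posets (the objects $G_0$ and the arrows $G_1$ are posets and all structure maps are monotone) whose domain map $\mathbf d\colon G_1\to G_0$ is a discrete fibration, where a monotone map $p\colon P\to Q$ of posets is a discrete fibration if for all $y\in P$ and $x\le p(y)$ there is a unique $z\le y$ with $p(z)=x$. Write $\mathbf r$ for the range map, and $gh$ for the product of $g$ and $h$, which is defined when $\mathbf d(g)=\mathbf r(h)$. If the meet $e=\mathbf d(g)\wedge\mathbf r(h)$ exists in $G_0$, the pseudoproduct of $g$ and $h$ is $g\circ h=(g\mid e)(e\mid h)$, where $(g\mid e)$ is the unique arrow below $g$ with domain $e$ and $(e\mid h)$ is the unique arrow below $h$ with range $e$. Call $G$ principally inductive if for each $e\in G_0$ the poset $\{f\in G_0: f\le e\}$ is a meet semilattice. The classifying topos $\mathscr B(G)$ is the category of étale $G$-sets: posets $X$ with a discrete fibration $p\colon X\to G_0$ and a monotone right action of $G$ along $p$ (where $x\cdot g$ is defined when $p(x)=\mathbf r(g)$, and then $p(x\cdot g)=\mathbf d(g)$), with monotone equivariant maps over $G_0$ as morphisms. The category $L(G)$ has object set $G_0$; its morphisms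 $f\to e$ are the pairs $(e,g)$ with $g\in G_1$, $\mathbf d(g)=f$ and $\mathbf r(g)\le e$, composed by $(e,g)(f,h)=(e,g\circ h)$ when $\mathbf d(g)=f$. For $G$ principally inductive, the category $C(G)$ has object set $G_0$; its morphisms $f\to e$ are the triples $(e,x,f)$ with $x\in G_1$, $\mathbf d(x)\le f$ and $\mathbf r(x)\le e$, composed by $(e,x,f)(f,y,i)=(e,x\circ y,i)$. Two small categories $\mathbb A,\mathbb B$ form a Morita context if there are a small category $\mathbb U$ and functors $\mathbb A\to\mathbb U\leftarrow\mathbb B$ that are both full, faithful and essentially surjective on objects. Let $G$ and $H$ be principally inductive ordered groupoids. Then the following are equivalent: 1. the classifying toposes $\mathscr B(G)$ and $\mathscr B(H)$ are equivalent categories; 2. the categories $L(G)$ and $L(H)$ form a Morita context; 3. the categories $C(G)$ and $C(H)$ form a Morita context. -/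

import Mathlib

open CategoryTheory

universe u

/-- A monotone map of posets `f : P → Q` is a discrete fibration if every `x ≤ f y` has a unique
lifting to an element `z ≤ y`. -/
def IsDiscreteFibration {P Q : Type u} [PartialOrder P] [PartialOrder Q] (f : P → Q) : Prop :=
  Monotone f ∧ ∀ (y : P) (x : Q), x ≤ f y → ∃! z : P, z ≤ y ∧ f z = x

/-- An ordered groupoid: a groupoid internal to the category of posets (posets of objects and of
arrows, all structure maps monotone) whose domain map is a discrete fibration.
The product `comp g h` is "`g` after `h`", defined when `dom g = ran h`; the monotonicity of
`comp` is with respect to the product order on composable pairs. -/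
structure OrderedGroupoid where
  Obj : Type u
  Arr : Type u
  [objOrder : PartialOrder Obj]
  [arrOrder : PartialOrder Arr]
  dom : Arr → Obj
  ran : Arr → Obj
  one : Obj → Arr
  inv : Arr → Arr
  comp : (g h : Arr) → dom g = ran h → Arr
  dom_one : ∀ e, dom (one e) = e
  ran_one : ∀ e, ran (one e) = e
  dom_inv : ∀ g, dom (inv g) = ran g
  ran_inv : ∀ g, ran (inv g) = dom g
  dom_comp : ∀ g h w, dom (comp g h w) = dom h
  ran_comp : ∀ g h w, ran (comp g h w) = ran g
  one_comp : ∀ g, comp (one (ran g)) g (dom_one _) = g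
  comp_one : ∀ g, comp g (one (dom g)) (ran_one _).symm = g
  comp_assoc : ∀ g h k (w : dom g = ran h) (w' : dom h = ran k),
    comp (comp g h w) k ((dom_comp g h w).trans w') =
      comp g (comp h k w') (w.trans (ran_comp h k w').symm)
  inv_comp : ∀ g, comp (inv g) g (dom_inv g) = one (dom g)
  comp_inv : ∀ g, comp g (inv g) (ran_inv g).symm = one (ran g)
  ran_mono : Monotone ran
  one_mono : Monotone one
  inv_mono : Monotone inv
  comp_mono : ∀ g h g' h' w w', g ≤ g' → h ≤ h' → comp g h w ≤ comp g' h' w'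
  dom_fibration : IsDiscreteFibration dom

namespace OrderedGroupoid

attribute [instance] OrderedGroupoid.objOrder OrderedGroupoid.arrOrder

variable (G : OrderedGroupoid.{u})

theorem dom_mono : Monotone G.dom := G.dom_fibration.1

variable {G}

/-- The restriction `(g ∣ e)`: the unique arrow below `g` with domain `e`, for `e ≤ dom g`. -/
noncomputable def restrict (g : G.Arr) (e : G.Obj) (w : e ≤ G.dom g) : G.Arr :=
  (G.dom_fibration.2 g e w).choose

theorem restrict_le (g : G.Arr) (e : G.Obj) (w : e ≤ G.dom g) : restrict g e w ≤ g :=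
  (G.dom_fibration.2 g e w).choose_spec.1.1

theorem dom_restrict (g : G.Arr) (e : G.Obj) (w : e ≤ G.dom g) : G.dom (restrict g e w) = e :=
  (G.dom_fibration.2 g e w).choose_spec.1.2

/-- The corestriction `(e ∣ h)`: the unique arrow below `h` with range `e`, for `e ≤ ran h`. -/
noncomputable def corestrict (e : G.Obj) (h : G.Arr) (w : e ≤ G.ran h) : G.Arr :=
  G.inv (restrict (G.inv h) e (w.trans_eq (G.dom_inv h).symm))

theorem inv_inv (g : G.Arr) : G.inv (G.inv g) = g := by
  have h1 := G.comp_assoc (G.inv (G.inv g)) (G.inv g) g (G.dom_inv _) (G.dom_inv _)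
  simp only [G.inv_comp] at h1
  have h2 : ∀ (a : G.Arr) (e : G.Obj) w, G.comp (G.one e) a w = a := by
    intro a e w
    obtain rfl : e = G.ran a := by rw [← w, G.dom_one]
    exact G.one_comp a
  have h3 : ∀ (a : G.Arr) (e : G.Obj) w, G.comp a (G.one e) w = a := by
    intro a e w
    obtain rfl : e = G.dom a := by rw [w, G.ran_one]
    exact G.comp_one a
  rw [h2, h3] at h1
  exact h1.symm

theorem corestrict_le (e : G.Obj) (h : G.Arr) (w : e ≤ G.ran h) : corestrict e h w ≤ h :=
  (G.inv_mono (restrict_le _ _ _)).trans_eq (inv_inv h)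

theorem ran_corestrict (e : G.Obj) (h : G.Arr) (w : e ≤ G.ran h) :
    G.ran (corestrict e h w) = e := (G.ran_inv _).trans (dom_restrict _ _ _)

theorem eq_of_le_of_dom {a b g : G.Arr} (ha : a ≤ g) (hb : b ≤ g) (w : G.dom a = G.dom b) :
    a = b :=
  (G.dom_fibration.2 g (G.dom b) (G.dom_mono hb)).unique ⟨ha, w⟩ ⟨hb, rfl⟩

theorem eq_of_le_of_ran {a b g : G.Arr} (ha : a ≤ g) (hb : b ≤ g) (w : G.ran a = G.ran b) :
    a = b := by
  have h := eq_of_le_of_dom (G.inv_mono ha) (G.inv_mono hb) (by rw [G.dom_inv, G.dom_inv, w])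
  rw [← inv_inv a, h, inv_inv]

/-- The pseudoproduct `g ∘ h = (g ∣ e)(e ∣ h)`, where `e` is the meet of `dom g` and `ran h`. -/
noncomputable def pseudoproduct (g h : G.Arr) (e : G.Obj)
    (he : IsGLB {G.dom g, G.ran h} e) : G.Arr :=
  G.comp (restrict g e (he.1 (by simp))) (corestrict e h (he.1 (by simp)))
    ((dom_restrict _ _ _).trans (ran_corestrict _ _ _).symm)

/-- The products of composable arrows below `g` and `h`. -/
def productsBelow (g h : G.Arr) : Set G.Arr :=
  {x | ∃ (g' h' : G.Arr) (w : G.dom g' = G.ran h'), g' ≤ g ∧ h' ≤ h ∧ G.comp g' h' w = x}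

theorem pseudoproduct_isGreatest (g h : G.Arr) (e : G.Obj)
    (he : IsGLB {G.dom g, G.ran h} e) :
    IsGreatest (productsBelow g h) (pseudoproduct g h e he) := by
  refine ⟨⟨_, _, _, restrict_le _ _ _, corestrict_le _ _ _, rfl⟩, ?_⟩
  rintro _ ⟨g', h', w, hg, hh, rfl⟩
  have hle : G.dom g' ≤ e := he.2 (by
    rintro _ (rfl | rfl)
    · exact G.dom_mono hg
    · exact w.trans_le (G.ran_mono hh))
  apply G.comp_mono
  · have hr : restrict (restrict g e (he.1 (by simp))) (G.dom g')
        (by rw [dom_restrict]; exact hle) = g' :=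
      eq_of_le_of_dom ((restrict_le _ _ _).trans (restrict_le _ _ _)) hg (dom_restrict _ _ _)
    exact hr.symm.trans_le (restrict_le _ _ _)
  · have hr : corestrict (G.dom g') (corestrict e h (he.1 (by simp)))
        (by rw [ran_corestrict]; exact hle) = h' :=
      eq_of_le_of_ran ((corestrict_le _ _ _).trans (corestrict_le _ _ _)) hh
        ((ran_corestrict _ _ _).trans w)
    exact hr.symm.trans_le (corestrict_le _ _ _)

theorem exists_comp_of_le_comp {y g h : G.Arr} {w : G.dom g = G.ran h}
    (hy : y ≤ G.comp g h w) :
    ∃ (g' h' : G.Arr) (w' : G.dom g' = G.ran h'), g' ≤ g ∧ h' ≤ h ∧ G.comp g' h' w' = y := by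
  have h1 : G.dom y ≤ G.dom h := (G.dom_mono hy).trans_eq (G.dom_comp _ _ _)
  have h2 : G.ran (restrict h _ h1) ≤ G.dom g := (G.ran_mono (restrict_le _ _ _)).trans_eq w.symm
  refine ⟨restrict g _ h2, restrict h _ h1, dom_restrict _ _ _, restrict_le _ _ _,
    restrict_le _ _ _, ?_⟩
  exact eq_of_le_of_dom
    (G.comp_mono _ _ _ _ _ w (restrict_le _ _ _) (restrict_le _ _ _)) hy
    ((G.dom_comp _ _ _).trans (dom_restrict _ _ _))

theorem pseudo_assoc {g h k gh hk x y : G.Arr} (h1 : IsGreatest (productsBelow g h) gh)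
    (h2 : IsGreatest (productsBelow h k) hk) (h3 : IsGreatest (productsBelow gh k) x)
    (h4 : IsGreatest (productsBelow g hk) y) : x = y := by
  apply le_antisymm
  · obtain ⟨a, c, w, ha, hc, rfl⟩ := h3.1
    obtain ⟨g1, k1, w1, hg1, hk1, rfl⟩ := h1.1
    obtain ⟨g2, b, w2, hg2, hb, rfl⟩ := exists_comp_of_le_comp ha
    have w3 : G.dom b = G.ran c := by rw [← w, G.dom_comp]
    rw [G.comp_assoc g2 b c w2 w3]
    exact h4.2 ⟨g2, _, _, hg2.trans hg1, h2.2 ⟨b, c, w3, hb.trans hk1, hc, rfl⟩, rfl⟩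
  · obtain ⟨a, c, w, ha, hc, rfl⟩ := h4.1
    obtain ⟨g1, k1, w1, hg1, hk1, rfl⟩ := h2.1
    obtain ⟨b, k2, w2, hb, hk2, rfl⟩ := exists_comp_of_le_comp hc
    have w3 : G.dom a = G.ran b := by rw [w, G.ran_comp]
    rw [← G.comp_assoc a b k2 w3 w2]
    exact h3.2 ⟨_, k2, _, h1.2 ⟨a, b, w3, ha, hb.trans hg1, rfl⟩, hk2.trans hk1, rfl⟩

theorem one_isGreatest (g : G.Arr) (f : G.Obj) (w : G.ran g ≤ f) :
    IsGreatest (productsBelow (G.one f) g) g := by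
  refine ⟨⟨G.one (G.ran g), g, G.dom_one _, G.one_mono w, le_rfl, G.one_comp g⟩, ?_⟩
  rintro _ ⟨a, b, w', ha, hb, rfl⟩
  have hda : G.dom a ≤ f := (G.dom_mono ha).trans_eq (G.dom_one f)
  have : a = G.one (G.ran b) :=
    eq_of_le_of_dom ha (G.one_mono (w'.symm.trans_le hda)) (by rw [w', G.dom_one])
  subst this
  rwa [G.one_comp]

theorem isGreatest_one (g : G.Arr) (f : G.Obj) (w : G.dom g ≤ f) :
    IsGreatest (productsBelow g (G.one f)) g := by
  refine ⟨⟨g, G.one (G.dom g), (G.ran_one _).symm, le_rfl, G.one_mono w, G.comp_one g⟩, ?_⟩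
  rintro _ ⟨a, b, w', ha, hb, rfl⟩
  have hrb : G.ran b ≤ f := (G.ran_mono hb).trans_eq (G.ran_one f)
  have : b = G.one (G.dom a) :=
    eq_of_le_of_ran hb (G.one_mono (w'.trans_le hrb)) (by rw [← w', G.ran_one])
  subst this
  rwa [G.comp_one]

theorem dom_pseudoproduct_le (g h : G.Arr) (e : G.Obj) (he : IsGLB {G.dom g, G.ran h} e) :
    G.dom (pseudoproduct g h e he) ≤ G.dom h :=
  (G.dom_comp _ _ _).trans_le (G.dom_mono (corestrict_le _ _ _))

theorem ran_pseudoproduct_le (g h : G.Arr) (e : G.Obj) (he : IsGLB {G.dom g, G.ran h} e) :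
    G.ran (pseudoproduct g h e he) ≤ G.ran g :=
  (G.ran_comp _ _ _).trans_le (G.ran_mono (restrict_le _ _ _))

theorem isGLB_ran {g h : G.Arr} (w : G.ran h ≤ G.dom g) : IsGLB {G.dom g, G.ran h} (G.ran h) :=
  ⟨by rintro _ (rfl | rfl); exacts [w, le_rfl], fun _ hx => hx (by simp)⟩

theorem dom_pseudoproduct_ran (g h : G.Arr) (w : G.ran h ≤ G.dom g) :
    G.dom (pseudoproduct g h _ (isGLB_ran w)) = G.dom h := by
  have : corestrict (G.ran h) h le_rfl = h :=
    eq_of_le_of_ran (corestrict_le _ _ _) le_rfl (ran_corestrict _ _ _)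
  exact (G.dom_comp _ _ _).trans (by rw [this])

variable (G)

/-- The category `L(G)`: its objects are the objects of `G`, and its arrows `f ⟶ e` are the pairs
`(e, g)` with `dom g = f` and `ran g ≤ e`. -/
@[ext]
structure LCat where
  obj : G.Obj

/-- The arrows of `L(G)`. -/
@[ext]
structure LCat.Hom (f e : LCat G) where
  arr : G.Arr
  dom_eq : G.dom arr = f.obj
  ran_le : G.ran arr ≤ e.obj

/-- Composition in `L(G)` is the pseudoproduct: `(e, g)(f, h) = (e, g ∘ h)`. -/
noncomputable def LCat.Hom.comp {a f e : LCat G} (g : LCat.Hom G f e) (h : LCat.Hom G a f) :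
    LCat.Hom G a e where
  arr := pseudoproduct g.arr h.arr (G.ran h.arr) (isGLB_ran (h.ran_le.trans_eq g.dom_eq.symm))
  dom_eq := (dom_pseudoproduct_ran _ _ (h.ran_le.trans_eq g.dom_eq.symm)).trans h.dom_eq
  ran_le := (ran_pseudoproduct_le _ _ _ _).trans g.ran_le

theorem LCat.Hom.comp_isGreatest {a f e : LCat G} (g : LCat.Hom G f e) (h : LCat.Hom G a f) :
    IsGreatest (productsBelow g.arr h.arr) (LCat.Hom.comp G g h).arr :=
  pseudoproduct_isGreatest _ _ _ (isGLB_ran (h.ran_le.trans_eq g.dom_eq.symm))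

/-- The category structure of `L(G)`; the identity at `e` is `(e, e)`. -/
noncomputable instance : Category.{u} (LCat G) where
  Hom f e := LCat.Hom G f e
  id e := ⟨G.one e.obj, G.dom_one _, (G.ran_one _).le⟩
  comp h g := LCat.Hom.comp G g h
  id_comp g := LCat.Hom.ext ((LCat.Hom.comp_isGreatest G g _).unique
    (isGreatest_one _ _ g.dom_eq.le))
  comp_id g := LCat.Hom.ext ((LCat.Hom.comp_isGreatest G _ g).unique
    (one_isGreatest _ _ g.ran_le))
  assoc k h g := LCat.Hom.ext
    (pseudo_assoc (LCat.Hom.comp_isGreatest G g h) (LCat.Hom.comp_isGreatest G h k)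
      (LCat.Hom.comp_isGreatest G _ k) (LCat.Hom.comp_isGreatest G g _)).symm

/-- `G` is principally inductive if for each object `e` the poset `{f ∣ f ≤ e}` is a meet
semilattice under the induced order. -/
class PrincipallyInductive : Prop where
  exists_meet : ∀ (e : G.Obj) (a b : Set.Iic e), ∃ c : Set.Iic e, IsGLB {a, b} c

variable {G}

/-- A meet in `{c ∣ c ≤ e}` is a meet in the poset of all objects. -/
theorem exists_isGLB [G.PrincipallyInductive] {a b e : G.Obj} (ha : a ≤ e) (hb : b ≤ e) :
    ∃ c : G.Obj, IsGLB {a, b} c := by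
  obtain ⟨c, hc1, hc2⟩ := PrincipallyInductive.exists_meet e ⟨a, ha⟩ ⟨b, hb⟩
  refine ⟨c, ?_, ?_⟩
  · rintro _ (rfl | rfl)
    · exact hc1 (a := ⟨_, ha⟩) (by simp)
    · exact hc1 (a := ⟨_, hb⟩) (by simp)
  · intro x hx
    have hxa : x ≤ a := hx (by simp)
    have hxb : x ≤ b := hx (by simp)
    refine hc2 (a := ⟨x, hxa.trans ha⟩) ?_
    rintro _ (rfl | rfl)
    · exact hxa
    · exact hxb

variable (G)

/-- The category `C(G)` of a principally inductive ordered groupoid: its objects are the objects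
of `G`, and its arrows `f ⟶ e` are the triples `(e, x, f)` with `dom x ≤ f` and `ran x ≤ e`. -/
@[ext]
structure CCat where
  obj : G.Obj

/-- The arrows of `C(G)`. -/
@[ext]
structure CCat.Hom (f e : CCat G) where
  arr : G.Arr
  dom_le : G.dom arr ≤ f.obj
  ran_le : G.ran arr ≤ e.obj

/-- Composition in `C(G)` is the pseudoproduct: `(e, x, f)(f, y, i) = (e, x ∘ y, i)`. -/
noncomputable def CCat.Hom.comp [G.PrincipallyInductive] {i f e : CCat G}
    (x : CCat.Hom G f e) (y : CCat.Hom G i f) : CCat.Hom G i e where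
  arr := pseudoproduct x.arr y.arr (exists_isGLB x.dom_le y.ran_le).choose
    (exists_isGLB x.dom_le y.ran_le).choose_spec
  dom_le := (dom_pseudoproduct_le _ _ _ _).trans y.dom_le
  ran_le := (ran_pseudoproduct_le _ _ _ _).trans x.ran_le

theorem CCat.Hom.comp_isGreatest [G.PrincipallyInductive] {i f e : CCat G}
    (x : CCat.Hom G f e) (y : CCat.Hom G i f) :
    IsGreatest (productsBelow x.arr y.arr) (CCat.Hom.comp G x y).arr :=
  pseudoproduct_isGreatest _ _ _ (exists_isGLB x.dom_le y.ran_le).choose_spec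

/-- The category structure of `C(G)`; the identity at `e` is `(e, e, e)`. -/
noncomputable instance [G.PrincipallyInductive] : Category.{u} (CCat G) where
  Hom f e := CCat.Hom G f e
  id e := ⟨G.one e.obj, (G.dom_one _).le, (G.ran_one _).le⟩
  comp y x := CCat.Hom.comp G x y
  id_comp x := CCat.Hom.ext ((CCat.Hom.comp_isGreatest G x _).unique
    (isGreatest_one _ _ x.dom_le))
  comp_id x := CCat.Hom.ext ((CCat.Hom.comp_isGreatest G _ x).unique
    (one_isGreatest _ _ x.ran_le))
  assoc z y x := CCat.Hom.ext
    (pseudo_assoc (CCat.Hom.comp_isGreatest G x y) (CCat.Hom.comp_isGreatest G y z)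
      (CCat.Hom.comp_isGreatest G _ z) (CCat.Hom.comp_isGreatest G x _)).symm

/-- An étale (right) `G`-set: an étale map `p : X → G₀`, i.e. a discrete fibration of posets,
together with a right action of the groupoid `G` along `p` that is monotone (i.e. continuous for
the Alexandrov topologies). The action `x · g` is defined when `p x = ran g`. -/
structure EtaleSet where
  carrier : Type u
  [order : PartialOrder carrier]
  p : carrier → G.Obj
  fibration : IsDiscreteFibration p
  act : (x : carrier) → (g : G.Arr) → p x = G.ran g → carrier
  p_act : ∀ x g w, p (act x g w) = G.dom g
  act_one : ∀ x, act x (G.one (p x)) (G.ran_one _).symm = x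
  act_comp : ∀ x g h (w : p x = G.ran g) (w' : G.dom g = G.ran h),
    act x (G.comp g h w') (w.trans (G.ran_comp g h w').symm) =
      act (act x g w) h ((p_act x g w).trans w')
  act_mono : ∀ x y g h w w', x ≤ y → g ≤ h → act x g w ≤ act y h w'

attribute [instance] EtaleSet.order

/-- Morphisms of étale `G`-sets: equivariant étale (equivalently, monotone) maps over `G₀`. -/
@[ext]
structure EtaleSet.Hom (X Y : EtaleSet G) where
  toFun : X.carrier → Y.carrier
  mono : Monotone toFun
  p_map : ∀ x, Y.p (toFun x) = X.p x
  map_act : ∀ x g w, toFun (X.act x g w) = Y.act (toFun x) g ((p_map x).trans w)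

/-- The classifying topos `ℬ(G)`: the category of étale `G`-sets. -/
instance : Category.{u} (EtaleSet G) where
  Hom X Y := EtaleSet.Hom G X Y
  id X := ⟨id, monotone_id, fun _ => rfl, fun _ _ _ => rfl⟩
  comp a b := ⟨b.toFun ∘ a.toFun, b.mono.comp a.mono,
    fun x => (b.p_map _).trans (a.p_map x), fun x g w => by
      simp only [Function.comp_apply, a.map_act, b.map_act]⟩

end OrderedGroupoid

/-- A weak equivalence: a full and faithful functor that is essentially surjective on objects. -/
def IsWeakEquivalence {A B : Type u} [Category.{u} A] [Category.{u} B] (F : A ⥤ B) : Prop :=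
  F.Full ∧ F.Faithful ∧ F.EssSurj

/-- The categories `A` and `B` form a Morita context: there are a category `U` and weak
equivalences `A ⥤ U` and `B ⥤ U`. -/
def HaveMoritaContext (A B : Type u) [Category.{u} A] [Category.{u} B] : Prop :=
  ∃ (U : Type u) (_ : Category.{u} U) (P : A ⥤ U) (Q : B ⥤ U),
    IsWeakEquivalence P ∧ IsWeakEquivalence Q

open Opposite

theorem HaveMoritaContext.of_isWeakEquivalence {A B : Type u} [Category.{u} A] [Category.{u} B]
    (F : A ⥤ B) (h : IsWeakEquivalence F) : HaveMoritaContext A B :=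
  ⟨B, inferInstance, F, 𝟭 B, h, inferInstance, inferInstance, inferInstance⟩

theorem HaveMoritaContext.nonempty_equivalence {A B : Type u} [Category.{u} A] [Category.{u} B]
    (h : HaveMoritaContext A B) : Nonempty (A ≌ B) := by
  obtain ⟨U, _, P, Q, ⟨_, _, _⟩, _, _, _⟩ := h
  have : P.IsEquivalence := {}
  have : Q.IsEquivalence := {}
  exact ⟨P.asEquivalence.trans Q.asEquivalence.symm⟩

/-- The subpresheaf of a representable presheaf formed by the arrows which are not split epi. -/
def nonSplitEpi {A : Type u} [Category.{u} A] (a : A) : Subfunctor (yoneda.obj a) where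
  obj c := {k | ¬ IsSplitEpi (show unop c ⟶ a from k)}
  map {c d} i k hk h := hk <| by
    obtain ⟨⟨s, hs⟩⟩ := h
    exact ⟨⟨s ≫ i.unop, by simpa using hs⟩⟩

theorem exists_splitEpi_yoneda {A B : Type u} [Category.{u} A] [Category.{u} B]
    (F : (Aᵒᵖ ⥤ Type u) ⥤ (Bᵒᵖ ⥤ Type u)) [F.IsEquivalence] (a : A) :
    ∃ (b : B) (x : yoneda.obj b ⟶ F.obj (yoneda.obj a)), IsSplitEpi x := by
  by_contra! h
  have key : ∀ (b : B) (x : yoneda.obj b ⟶ F.obj (yoneda.obj a)),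
      ∃ y, x = y ≫ F.map (nonSplitEpi a).ι := by
    intro b x
    obtain ⟨X, ⟨i⟩⟩ : ∃ X, Nonempty (F.obj X ≅ yoneda.obj b) :=
      ⟨F.objPreimage _, ⟨F.objObjPreimageIso _⟩⟩
    obtain ⟨f, hf⟩ := F.map_surjective (i.hom ≫ x)
    have hx : x = i.inv ≫ F.map f := by rw [hf]; simp
    have hrange : ∀ c, ∀ t : X.obj c, f.app c t ∈ (nonSplitEpi a).obj c := by
      intro c t hsplit
      obtain ⟨⟨s, hs⟩⟩ := hsplit
      refine h b x ⟨⟨F.map (yonedaEquiv.symm (X.map s.op t)) ≫ i.hom, ?_⟩⟩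
      rw [hx, Category.assoc, i.hom_inv_id_assoc, ← F.map_comp, ← F.map_id]
      congr 1
      apply yonedaEquiv.injective
      rw [yonedaEquiv_comp, Equiv.apply_symm_apply, NatTrans.naturality_apply]
      exact hs
    refine ⟨i.inv ≫ F.map { app := fun c => TypeCat.ofHom fun t => ⟨f.app c t, hrange c t⟩,
                            naturality := ?_ }, ?_⟩
    · intro c d g
      ext t
      apply Subtype.ext
      exact NatTrans.naturality_apply f g t
    · rw [hx, Category.assoc, ← F.map_comp]
      rfl
  have hepi : Epi (F.map (nonSplitEpi a).ι) := by
    have : ∀ c, Epi ((F.map (nonSplitEpi a).ι).app c) := by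
      intro c
      rw [epi_iff_surjective]
      intro t
      obtain ⟨y, hy⟩ := key (unop c) (yonedaEquiv.symm t)
      refine ⟨yonedaEquiv y, ?_⟩
      have := congrArg yonedaEquiv hy
      rw [Equiv.apply_symm_apply, yonedaEquiv_comp] at this
      exact this.symm
    exact NatTrans.epi_of_epi_app _
  have hepi' : Epi (nonSplitEpi a).ι := F.epi_of_epi_map hepi
  have := (NatTrans.epi_iff_epi_app _).1 hepi' (op a)
  rw [epi_iff_surjective] at this
  obtain ⟨⟨k, hk⟩, hk'⟩ := this (𝟙 a)
  obtain rfl : k = 𝟙 a := hk'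
  exact hk (inferInstanceAs (IsSplitEpi (𝟙 a)))

theorem exists_iso_yoneda {A B : Type u} [Category.{u} A] [Category.{u} B]
    (hB : ∀ (b : B) (e : b ⟶ b), e ≫ e = e → e = 𝟙 b)
    (F : (Aᵒᵖ ⥤ Type u) ⥤ (Bᵒᵖ ⥤ Type u)) [F.IsEquivalence] (a : A) :
    (yoneda (C := B)).essImage (F.obj (yoneda.obj a)) := by
  obtain ⟨b, x, ⟨⟨s, hs⟩⟩⟩ := exists_splitEpi_yoneda F a
  obtain ⟨e, he⟩ := yoneda.map_surjective (x ≫ s)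
  have : e = 𝟙 b := hB b e <| yoneda.map_injective <| by
    rw [yoneda.map_comp, he]; simp [reassoc_of% hs]
  exact ⟨b, ⟨⟨x, s, by rw [← he, this, yoneda.map_id], hs⟩⟩⟩

theorem HaveMoritaContext.of_presheaf_equivalence {A B : Type u} [Category.{u} A] [Category.{u} B]
    (hA : ∀ (a : A) (e : a ⟶ a), e ≫ e = e → e = 𝟙 a)
    (hB : ∀ (b : B) (e : b ⟶ b), e ≫ e = e → e = 𝟙 b)
    (E : (Aᵒᵖ ⥤ Type u) ≌ (Bᵒᵖ ⥤ Type u)) : HaveMoritaContext A B := by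
  have hF : ∀ a : A, (yoneda (C := B)).essImage ((yoneda ⋙ E.functor).obj a) :=
    exists_iso_yoneda hB E.functor
  have : (yoneda (C := B)).toEssImage.IsEquivalence := {}
  have hess : ((yoneda (C := B)).essImage.lift (yoneda ⋙ E.functor) hF).EssSurj := by
    refine ⟨fun ⟨Y, b, ⟨i⟩⟩ => ?_⟩
    obtain ⟨a, ⟨j⟩⟩ := exists_iso_yoneda hA E.inverse b
    exact ⟨a, ⟨(yoneda (C := B)).essImage.fullyFaithfulι.preimageIso
      (E.functor.mapIso j ≪≫ E.counitIso.app _ ≪≫ i)⟩⟩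
  exact .of_isWeakEquivalence
    ((yoneda (C := B)).essImage.lift (yoneda ⋙ E.functor) hF ⋙ (yoneda (C := B)).toEssImage.inv)
    ⟨inferInstance, inferInstance, inferInstance⟩

namespace OrderedGroupoid

theorem productsBelow_mono {G : OrderedGroupoid.{u}} {g g' h h' : G.Arr} (hg : g ≤ g')
    (hh : h ≤ h') : productsBelow g h ⊆ productsBelow g' h' := by
  rintro _ ⟨a, b, w, ha, hb, rfl⟩
  exact ⟨a, b, w, ha.trans hg, hb.trans hh, rfl⟩

theorem comp_isGreatest {G : OrderedGroupoid.{u}} (g h : G.Arr) (w : G.dom g = G.ran h) :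
    IsGreatest (productsBelow g h) (G.comp g h w) := by
  refine ⟨⟨g, h, w, le_rfl, le_rfl, rfl⟩, ?_⟩
  rintro _ ⟨a, b, w', ha, hb, rfl⟩
  exact G.comp_mono _ _ _ _ _ _ ha hb

theorem inv_one {G : OrderedGroupoid.{u}} (e : G.Obj) : G.inv (G.one e) = G.one e := by
  have h3 : ∀ (a : G.Arr) (e : G.Obj) w, G.comp a (G.one e) w = a := by
    intro a e w
    obtain rfl : e = G.dom a := by rw [w, G.ran_one]
    exact G.comp_one a
  have := G.inv_comp (G.one e)
  rwa [h3, G.dom_one] at this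

section

variable {G : OrderedGroupoid.{u}} [G.PrincipallyInductive]

namespace CCat

/-- The arrow of `G` underlying a morphism of `C(G)`. -/
def arr {f e : CCat G} (x : f ⟶ e) : G.Arr := CCat.Hom.arr x

theorem hom_ext {f e : CCat G} {x y : f ⟶ e} (h : arr x = arr y) : x = y := CCat.Hom.ext h

theorem dom_arr_le {f e : CCat G} (x : f ⟶ e) : G.dom (arr x) ≤ f.obj := CCat.Hom.dom_le x

theorem ran_arr_le {f e : CCat G} (x : f ⟶ e) : G.ran (arr x) ≤ e.obj := CCat.Hom.ran_le x

theorem arr_id (f : CCat G) : arr (𝟙 f) = G.one f.obj := rfl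

theorem arr_comp_isGreatest {i f e : CCat G} (y : i ⟶ f) (x : f ⟶ e) :
    IsGreatest (productsBelow (arr x) (arr y)) (arr (y ≫ x)) :=
  CCat.Hom.comp_isGreatest G x y

theorem dom_arr_comp_le {i f e : CCat G} (y : i ⟶ f) (x : f ⟶ e) :
    G.dom (arr (y ≫ x)) ≤ G.dom (arr y) := by
  obtain ⟨a, b, w, ha, hb, h⟩ := (arr_comp_isGreatest y x).1
  rw [← h, G.dom_comp]
  exact G.dom_mono hb

theorem arr_comp_le {i f : CCat G} (y : i ⟶ f) (z : f ⟶ f) (hz : arr z ≤ G.one f.obj) :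
    arr (y ≫ z) ≤ arr y :=
  (one_isGreatest _ _ (ran_arr_le y)).2
    (productsBelow_mono hz le_rfl (arr_comp_isGreatest y z).1)

/-- The inverse in the inverse category `C(G)`. -/
def star {f e : CCat G} (x : f ⟶ e) : e ⟶ f :=
  (⟨G.inv (arr x), (G.dom_inv _).trans_le (ran_arr_le x),
    (G.ran_inv _).trans_le (dom_arr_le x)⟩ : CCat.Hom G e f)

theorem comp_star {f e : CCat G} (x : f ⟶ e) (h : G.dom (arr x) = f.obj) :
    x ≫ star x = 𝟙 f := by
  apply hom_ext
  rw [(arr_comp_isGreatest x (star x)).unique (comp_isGreatest _ _ (G.dom_inv _)), G.inv_comp,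
    h, arr_id]

theorem arr_star_comp {f e : CCat G} (x : f ⟶ e) :
    arr (star x ≫ x) = G.one (G.ran (arr x)) := by
  rw [(arr_comp_isGreatest (star x) x).unique (comp_isGreatest _ _ (G.ran_inv _).symm),
    G.comp_inv]

theorem isSplitMono_iff {f e : CCat G} (x : f ⟶ e) :
    IsSplitMono x ↔ G.dom (arr x) = f.obj := by
  constructor
  · rintro ⟨⟨r, hr⟩⟩
    refine (dom_arr_le x).antisymm ?_
    have := dom_arr_comp_le x r
    rwa [hr, arr_id, G.dom_one] at this
  · exact fun h => ⟨⟨star x, comp_star x h⟩⟩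

end CCat

open CCat

variable (G) in
/-- The inclusion of `L(G)` in `C(G)`, as the wide subcategory of split monomorphisms. -/
noncomputable def LCat.toCCat : LCat G ⥤ CCat G where
  obj f := ⟨f.obj⟩
  map g := (⟨LCat.Hom.arr g, (LCat.Hom.dom_eq g).le, LCat.Hom.ran_le g⟩ : CCat.Hom G _ _)
  map_id _ := rfl
  map_comp h g := CCat.hom_ext ((LCat.Hom.comp_isGreatest G g h).unique
    (arr_comp_isGreatest (G := G) (⟨h.arr, h.dom_eq.le, h.ran_le⟩ : CCat.Hom G _ _)
      (⟨g.arr, g.dom_eq.le, g.ran_le⟩ : CCat.Hom G _ _)))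

namespace LCat

instance : (toCCat G).Faithful where
  map_injective h := LCat.Hom.ext (congrArg arr h)

theorem dom_arr_map {f e : LCat G} (u : f ⟶ e) : G.dom (arr ((toCCat G).map u)) = f.obj :=
  LCat.Hom.dom_eq u

theorem exists_map_eq {f e : LCat G} (x : (toCCat G).obj f ⟶ (toCCat G).obj e)
    (h : G.dom (arr x) = f.obj) : ∃ u, (toCCat G).map u = x :=
  ⟨(⟨arr x, h, ran_arr_le x⟩ : LCat.Hom G f e), rfl⟩

theorem exists_map_eq_of_isSplitMono {f e : LCat G} (x : (toCCat G).obj f ⟶ (toCCat G).obj e)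
    (h : IsSplitMono x) : ∃ u, (toCCat G).map u = x :=
  exists_map_eq x ((isSplitMono_iff x).1 h)

instance {f e : LCat G} (u : f ⟶ e) : IsSplitMono ((toCCat G).map u) :=
  (isSplitMono_iff _).2 (dom_arr_map u)

theorem eq_id_of_idem {f : LCat G} (e : f ⟶ f) (h : e ≫ e = e) : e = 𝟙 f := by
  have : Mono e := (toCCat G).mono_of_mono_map inferInstance
  rw [← cancel_mono e, h, Category.id_comp]

/-- The morphism of `C(G)` determined by a span in `L(G)`. -/
noncomputable def spanHom {a f e : LCat G} (u : a ⟶ f) (v : a ⟶ e) :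
    (toCCat G).obj f ⟶ (toCCat G).obj e :=
  star ((toCCat G).map u) ≫ (toCCat G).map v

/-- The domain of definition of a morphism of `C(G)`. -/
noncomputable def domOf {f e : LCat G} (x : (toCCat G).obj f ⟶ (toCCat G).obj e) : LCat G := ⟨G.dom (arr x)⟩

/-- The inclusion of the domain of definition of a morphism of `C(G)`. -/
noncomputable def domIncl {f e : LCat G} (x : (toCCat G).obj f ⟶ (toCCat G).obj e) : domOf x ⟶ f :=
  (⟨G.one (G.dom (arr x)), G.dom_one _, (G.ran_one _).trans_le (dom_arr_le x)⟩ : LCat.Hom G _ _)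

/-- The total part of a morphism of `C(G)`. -/
noncomputable def totalPart {f e : LCat G} (x : (toCCat G).obj f ⟶ (toCCat G).obj e) : domOf x ⟶ e :=
  (⟨arr x, rfl, ran_arr_le x⟩ : LCat.Hom G _ _)

theorem domIncl_comp {f e : LCat G} (x : (toCCat G).obj f ⟶ (toCCat G).obj e) :
    (toCCat G).map (domIncl x) ≫ x = (toCCat G).map (totalPart x) :=
  hom_ext ((arr_comp_isGreatest _ x).unique (isGreatest_one _ _ le_rfl))

theorem spanHom_domIncl {f e : LCat G} (x : (toCCat G).obj f ⟶ (toCCat G).obj e) :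
    spanHom (domIncl x) (totalPart x) = x := by
  apply hom_ext
  refine (arr_comp_isGreatest _ _).unique ?_
  have h : arr (star ((toCCat G).map (domIncl x))) = G.one (G.dom (arr x)) := inv_one _
  rw [h]
  exact isGreatest_one _ _ le_rfl

theorem map_comp_spanHom_iff {b a f e : LCat G} (u : a ⟶ f) (v : a ⟶ e) (u' : b ⟶ f)
    (v' : b ⟶ e) : (toCCat G).map u' ≫ spanHom u v = (toCCat G).map v' ↔
      ∃ k : b ⟶ a, k ≫ u = u' ∧ k ≫ v = v' := by
  constructor
  · intro h
    rw [spanHom, ← Category.assoc] at h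
    obtain ⟨k, hk⟩ := exists_map_eq ((toCCat G).map u' ≫ star ((toCCat G).map u)) <| by
      refine (dom_arr_le (G := G) _).antisymm ?_
      refine le_trans ?_ (dom_arr_comp_le (G := G) _ ((toCCat G).map v))
      rw [h, dom_arr_map]
      rfl
    refine ⟨k, (toCCat G).map_injective (hom_ext ?_), (toCCat G).map_injective ?_⟩
    · have hle : arr ((toCCat G).map (k ≫ u)) ≤ arr ((toCCat G).map u') := by
        rw [(toCCat G).map_comp, hk, Category.assoc]
        refine arr_comp_le _ _ ?_
        rw [arr_star_comp]
        exact G.one_mono (ran_arr_le _)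
      exact eq_of_le_of_dom hle le_rfl (by rw [dom_arr_map, dom_arr_map])
    · rw [(toCCat G).map_comp, hk, h]
  · rintro ⟨k, rfl, rfl⟩
    rw [spanHom, (toCCat G).map_comp, Category.assoc,
      ← Category.assoc (toCCat G |>.map u), comp_star _ (dom_arr_map u), Category.id_comp,
      (toCCat G).map_comp]

theorem map_comp_comp_iff {a i f e : LCat G} (y : (toCCat G).obj i ⟶ (toCCat G).obj f)
    (x : (toCCat G).obj f ⟶ (toCCat G).obj e) (u : a ⟶ i) (w : a ⟶ e) :
    (toCCat G).map u ≫ y ≫ x = (toCCat G).map w ↔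
      ∃ v : a ⟶ f, (toCCat G).map u ≫ y = (toCCat G).map v ∧
        (toCCat G).map v ≫ x = (toCCat G).map w := by
  constructor
  · intro h
    rw [← Category.assoc] at h
    obtain ⟨v, hv⟩ := exists_map_eq ((toCCat G).map u ≫ y) <| by
      refine (dom_arr_le (G := G) _).antisymm ?_
      refine le_trans ?_ (dom_arr_comp_le (G := G) _ x)
      rw [h, dom_arr_map]
      rfl
    exact ⟨v, hv.symm, by rw [hv, h]⟩
  · rintro ⟨v, hv, hw⟩
    rw [← Category.assoc, hv, hw]

theorem arr_le_of_forall {f e : LCat G} (x y : (toCCat G).obj f ⟶ (toCCat G).obj e)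
    (h : ∀ (a : LCat G) (u : a ⟶ f) (v : a ⟶ e), (toCCat G).map u ≫ x = (toCCat G).map v →
      (toCCat G).map u ≫ y = (toCCat G).map v) : arr x ≤ arr y := by
  have h1 := congrArg arr (h _ _ _ (domIncl_comp x))
  have h2 := (arr_comp_isGreatest ((toCCat G).map (domIncl x)) y).1
  rw [h1] at h2
  exact (isGreatest_one _ _ (dom_arr_le y)).2
    (productsBelow_mono le_rfl (G.one_mono (dom_arr_le x)) h2)

end LCat

end

section

variable {G H : OrderedGroupoid.{u}} [H.PrincipallyInductive]

open CCat LCat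

section

variable (F : LCat G ⥤ LCat H)

theorem LCat.arr_le_of_forall_map [F.Full] [F.EssSurj] {f e : LCat G}
    (x y : (toCCat H).obj (F.obj f) ⟶ (toCCat H).obj (F.obj e))
    (h : ∀ (a : LCat G) (u : a ⟶ f) (v : a ⟶ e),
      (toCCat H).map (F.map u) ≫ x = (toCCat H).map (F.map v) →
      (toCCat H).map (F.map u) ≫ y = (toCCat H).map (F.map v)) : arr x ≤ arr y := by
  refine arr_le_of_forall x y fun b u' v' hx => ?_
  let i := F.objObjPreimageIso b
  obtain ⟨u, hu⟩ := F.map_surjective (i.hom ≫ u')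
  obtain ⟨v, hv⟩ := F.map_surjective (i.hom ≫ v')
  have := h _ u v (by rw [hu, hv, Functor.map_comp, Functor.map_comp, Category.assoc, hx])
  rwa [hu, hv, Functor.map_comp, Functor.map_comp, Category.assoc, cancel_epi] at this

theorem LCat.eq_of_forall_map [F.Full] [F.EssSurj] {f e : LCat G}
    {x y : (toCCat H).obj (F.obj f) ⟶ (toCCat H).obj (F.obj e)}
    (h : ∀ (a : LCat G) (u : a ⟶ f) (v : a ⟶ e),
      (toCCat H).map (F.map u) ≫ x = (toCCat H).map (F.map v) ↔
      (toCCat H).map (F.map u) ≫ y = (toCCat H).map (F.map v)) : x = y :=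
  hom_ext ((arr_le_of_forall_map F x y fun a u v => (h a u v).1).antisymm
    (arr_le_of_forall_map F y x fun a u v => (h a u v).2))

variable [G.PrincipallyInductive]

/-- The action on morphisms of the functor `C(G) ⥤ C(H)` induced by a functor `L(G) ⥤ L(H)`. -/
noncomputable def LCat.mapSpan {f e : LCat G} (x : (toCCat G).obj f ⟶ (toCCat G).obj e) :
    (toCCat H).obj (F.obj f) ⟶ (toCCat H).obj (F.obj e) :=
  spanHom (F.map (domIncl x)) (F.map (totalPart x))

theorem LCat.map_comp_mapSpan_iff [F.Full] [F.Faithful] {a f e : LCat G}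
    (x : (toCCat G).obj f ⟶ (toCCat G).obj e) (u : a ⟶ f) (v : a ⟶ e) :
    (toCCat H).map (F.map u) ≫ mapSpan F x = (toCCat H).map (F.map v) ↔
      (toCCat G).map u ≫ x = (toCCat G).map v := by
  conv_rhs => rw [← spanHom_domIncl x]
  rw [mapSpan, map_comp_spanHom_iff, map_comp_spanHom_iff]
  constructor
  · rintro ⟨k, h1, h2⟩
    obtain ⟨k, rfl⟩ := F.map_surjective k
    exact ⟨k, F.map_injective (by rw [F.map_comp, h1]), F.map_injective (by rw [F.map_comp, h2])⟩
  · rintro ⟨k, rfl, rfl⟩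
    exact ⟨F.map k, by simp, by simp⟩

theorem LCat.mapSpan_id [F.Full] [F.Faithful] [F.EssSurj] (f : LCat G) :
    mapSpan F (𝟙 ((toCCat G).obj f)) = 𝟙 _ :=
  eq_of_forall_map F fun a u v => by
    rw [map_comp_mapSpan_iff, Category.comp_id, Category.comp_id,
      (toCCat G).map_injective.eq_iff, (toCCat H).map_injective.eq_iff, F.map_injective.eq_iff]

theorem LCat.mapSpan_comp [F.Full] [F.Faithful] [F.EssSurj] {i f e : LCat G}
    (y : (toCCat G).obj i ⟶ (toCCat G).obj f) (x : (toCCat G).obj f ⟶ (toCCat G).obj e) :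
    mapSpan F (y ≫ x) = mapSpan F y ≫ mapSpan F x :=
  eq_of_forall_map F fun a u w => by
    rw [map_comp_mapSpan_iff, map_comp_comp_iff, map_comp_comp_iff]
    constructor
    · rintro ⟨v, h1, h2⟩
      exact ⟨F.map v, (map_comp_mapSpan_iff F _ _ _).2 h1, (map_comp_mapSpan_iff F _ _ _).2 h2⟩
    · rintro ⟨v, h1, h2⟩
      obtain ⟨v, rfl⟩ := F.map_surjective v
      exact ⟨v, (map_comp_mapSpan_iff F _ _ _).1 h1, (map_comp_mapSpan_iff F _ _ _).1 h2⟩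

theorem LCat.mapSpan_injective [F.Full] [F.Faithful] {f e : LCat G}
    {x y : (toCCat G).obj f ⟶ (toCCat G).obj e} (h : mapSpan F x = mapSpan F y) : x = y :=
  eq_of_forall_map (𝟭 _) fun a u v => by
    rw [Functor.id_map, Functor.id_map, ← map_comp_mapSpan_iff F, h, map_comp_mapSpan_iff]

theorem LCat.mapSpan_surjective [F.Full] [F.Faithful] [F.EssSurj] {f e : LCat G}
    (x' : (toCCat H).obj (F.obj f) ⟶ (toCCat H).obj (F.obj e)) : ∃ x, mapSpan F x = x' := by
  let i := F.objObjPreimageIso (domOf x')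
  obtain ⟨u, hu⟩ := F.map_surjective (i.hom ≫ domIncl x')
  obtain ⟨v, hv⟩ := F.map_surjective (i.hom ≫ totalPart x')
  refine ⟨spanHom u v, eq_of_forall_map F fun a s t => ?_⟩
  conv_rhs => rw [← spanHom_domIncl x']
  rw [map_comp_mapSpan_iff, map_comp_spanHom_iff, map_comp_spanHom_iff]
  constructor
  · rintro ⟨k, rfl, rfl⟩
    exact ⟨F.map k ≫ i.hom, by rw [F.map_comp, hu, Category.assoc],
      by rw [F.map_comp, hv, Category.assoc]⟩
  · rintro ⟨k, h1, h2⟩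
    obtain ⟨k', hk'⟩ := F.map_surjective (k ≫ i.inv)
    exact ⟨k', F.map_injective (by rw [F.map_comp, hu, hk', ← h1]; simp),
      F.map_injective (by rw [F.map_comp, hv, hk', ← h2]; simp)⟩

/-- The functor `C(G) ⥤ C(H)` induced by an equivalence `L(G) ⥤ L(H)`. -/
noncomputable def LCat.mapCCat [F.Full] [F.Faithful] [F.EssSurj] : CCat G ⥤ CCat H where
  obj c := (toCCat H).obj (F.obj ⟨c.obj⟩)
  map {c d} x := mapSpan F (f := ⟨c.obj⟩) (e := ⟨d.obj⟩) x
  map_id c := mapSpan_id F ⟨c.obj⟩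
  map_comp {c d k} y x := mapSpan_comp F (i := ⟨c.obj⟩) (f := ⟨d.obj⟩) (e := ⟨k.obj⟩) y x

theorem LCat.isWeakEquivalence_mapCCat [F.Full] [F.Faithful] [F.EssSurj] :
    IsWeakEquivalence (LCat.mapCCat F) :=
  ⟨⟨fun x' => mapSpan_surjective F x'⟩,
    ⟨fun {c d} _ _ h => mapSpan_injective F (f := ⟨c.obj⟩) (e := ⟨d.obj⟩) h⟩,
    ⟨fun d => ⟨(toCCat G).obj (F.objPreimage ⟨d.obj⟩),
      ⟨(toCCat H).mapIso (F.objObjPreimageIso ⟨d.obj⟩)⟩⟩⟩⟩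

end

variable [G.PrincipallyInductive] (F : CCat G ⥤ CCat H)

theorem CCat.exists_map_eq {f e : LCat G} (u : f ⟶ e) :
    ∃ v : (⟨(F.obj ((toCCat G).obj f)).obj⟩ : LCat H) ⟶ ⟨(F.obj ((toCCat G).obj e)).obj⟩,
      (toCCat H).map v = F.map ((toCCat G).map u) :=
  LCat.exists_map_eq_of_isSplitMono _ (inferInstanceAs (IsSplitMono (F.map ((toCCat G).map u))))

/-- The restriction of a functor `C(G) ⥤ C(H)` to split monomorphisms. -/
noncomputable def CCat.restrictLCat : LCat G ⥤ LCat H where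
  obj f := ⟨(F.obj ((toCCat G).obj f)).obj⟩
  map u := (CCat.exists_map_eq F u).choose
  map_id f := (toCCat H).map_injective <| (CCat.exists_map_eq F _).choose_spec.trans <|
    ((congrArg F.map ((toCCat G).map_id f)).trans (F.map_id _)).trans
      ((toCCat H).map_id ⟨(F.obj ((toCCat G).obj f)).obj⟩).symm
  map_comp u v := (toCCat H).map_injective <| (CCat.exists_map_eq F _).choose_spec.trans <|
    ((congrArg F.map ((toCCat G).map_comp u v)).trans (F.map_comp _ _)).trans <|
      (congrArg₂ (· ≫ ·) (CCat.exists_map_eq F u).choose_spec.symm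
        (CCat.exists_map_eq F v).choose_spec.symm).trans ((toCCat H).map_comp _ _).symm

theorem CCat.map_restrictLCat {f e : LCat G} (u : f ⟶ e) :
    (toCCat H).map ((restrictLCat F).map u) = F.map ((toCCat G).map u) :=
  (CCat.exists_map_eq F u).choose_spec

/-- An isomorphism of `C(G)` is an isomorphism of `L(G)`. -/
noncomputable def LCat.isoOfCCat {f e : LCat G} (i : (toCCat G).obj f ≅ (toCCat G).obj e) :
    f ≅ e where
  hom := (exists_map_eq_of_isSplitMono i.hom inferInstance).choose
  inv := (exists_map_eq_of_isSplitMono i.inv inferInstance).choose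
  hom_inv_id := (toCCat G).map_injective <| by
    rw [Functor.map_comp, (exists_map_eq_of_isSplitMono i.hom inferInstance).choose_spec,
      (exists_map_eq_of_isSplitMono i.inv inferInstance).choose_spec, i.hom_inv_id,
      (toCCat G).map_id]
  inv_hom_id := (toCCat G).map_injective <| by
    rw [Functor.map_comp, (exists_map_eq_of_isSplitMono i.hom inferInstance).choose_spec,
      (exists_map_eq_of_isSplitMono i.inv inferInstance).choose_spec, i.inv_hom_id,
      (toCCat G).map_id]

theorem CCat.isWeakEquivalence_restrictLCat [F.Full] [F.Faithful] [F.EssSurj] :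
    IsWeakEquivalence (CCat.restrictLCat F) := by
  refine ⟨⟨?_⟩, ⟨?_⟩, ⟨?_⟩⟩
  · intro f e g
    obtain ⟨x, hx⟩ := F.map_surjective (X := (toCCat G).obj f) (Y := (toCCat G).obj e)
      ((toCCat H).map g)
    have hs : IsSplitMono (F.map x) := by
      rw [hx]
      exact inferInstanceAs (IsSplitMono ((toCCat H).map g))
    obtain ⟨⟨r, hr⟩⟩ := hs
    obtain ⟨r, rfl⟩ := F.map_surjective r
    obtain ⟨u, rfl⟩ := exists_map_eq_of_isSplitMono x
      ⟨⟨r, F.map_injective (by rw [F.map_comp, hr, F.map_id])⟩⟩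
    exact ⟨u, (toCCat H).map_injective ((map_restrictLCat F u).trans hx)⟩
  · intro f e u v h
    apply (toCCat G).map_injective
    apply F.map_injective
    rw [← map_restrictLCat, ← map_restrictLCat, h]
  · intro d
    exact ⟨⟨(F.objPreimage ((toCCat H).obj d)).obj⟩,
      ⟨LCat.isoOfCCat (F.objObjPreimageIso ((toCCat H).obj d))⟩⟩

theorem haveMoritaContext_lCat_iff_cCat :
    HaveMoritaContext (LCat G) (LCat H) ↔ HaveMoritaContext (CCat G) (CCat H) := by
  constructor
  · intro h
    obtain ⟨E⟩ := h.nonempty_equivalence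
    exact .of_isWeakEquivalence _ (LCat.isWeakEquivalence_mapCCat E.functor)
  · intro h
    obtain ⟨E⟩ := h.nonempty_equivalence
    exact .of_isWeakEquivalence _ (CCat.isWeakEquivalence_restrictLCat E.functor)

end

end OrderedGroupoid

theorem IsDiscreteFibration.le_of_le {P Q : Type u} [PartialOrder P] [PartialOrder Q] {f : P → Q}
    (hf : IsDiscreteFibration f) {a b y : P} (ha : a ≤ y) (hb : b ≤ y) (h : f a ≤ f b) :
    a ≤ b := by
  obtain ⟨z, ⟨hz, hz'⟩, -⟩ := hf.2 b (f a) h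
  rwa [(hf.2 y (f a) (hf.1 ha)).unique ⟨ha, rfl⟩ ⟨hz.trans hb, hz'⟩]

theorem IsDiscreteFibration.eq_of_le {P Q : Type u} [PartialOrder P] [PartialOrder Q] {f : P → Q}
    (hf : IsDiscreteFibration f) {a b y : P} (ha : a ≤ y) (hb : b ≤ y) (h : f a = f b) :
    a = b :=
  (hf.le_of_le ha hb h.le).antisymm (hf.le_of_le hb ha h.ge)

namespace OrderedGroupoid

variable {G : OrderedGroupoid.{u}}

namespace LCat

/-- The arrow of `G` underlying a morphism of `L(G)`. -/
def arr {f e : LCat G} (u : f ⟶ e) : G.Arr := LCat.Hom.arr u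

theorem hom_ext {f e : LCat G} {u v : f ⟶ e} (h : arr u = arr v) : u = v := LCat.Hom.ext h

theorem dom_arr {f e : LCat G} (u : f ⟶ e) : G.dom (arr u) = f.obj := LCat.Hom.dom_eq u

theorem ran_arr_le {f e : LCat G} (u : f ⟶ e) : G.ran (arr u) ≤ e.obj := LCat.Hom.ran_le u

theorem arr_comp_isGreatest {a f e : LCat G} (v : a ⟶ f) (u : f ⟶ e) :
    IsGreatest (productsBelow (arr u) (arr v)) (arr (v ≫ u)) :=
  LCat.Hom.comp_isGreatest G u v

/-- The morphism of `L(G)` given by an arrow of `G`. -/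
def ofArr {e : G.Obj} (g : G.Arr) (h : G.ran g ≤ e) : (⟨G.dom g⟩ : LCat G) ⟶ ⟨e⟩ :=
  (⟨g, rfl, h⟩ : LCat.Hom G _ _)

/-- The morphism of `L(G)` given by an inequality. -/
def incl {f e : G.Obj} (h : f ≤ e) : (⟨f⟩ : LCat G) ⟶ ⟨e⟩ :=
  (⟨G.one f, G.dom_one f, (G.ran_one f).trans_le h⟩ : LCat.Hom G _ _)

theorem incl_refl (e : G.Obj) : incl (le_refl e) = 𝟙 (⟨e⟩ : LCat G) := rfl

theorem arr_comp_incl {a : LCat G} {f e : G.Obj} (v : a ⟶ ⟨f⟩) (h : f ≤ e) :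
    arr (v ≫ incl h) = arr v :=
  (arr_comp_isGreatest v (incl h)).unique (one_isGreatest _ _ (ran_arr_le v))

theorem arr_incl_comp_le {e : LCat G} {a f : G.Obj} (h : a ≤ f) (u : ⟨f⟩ ⟶ e) :
    arr (incl h ≫ u) ≤ arr u :=
  (isGreatest_one _ _ (dom_arr u).le).2
    (productsBelow_mono le_rfl (G.one_mono h) (arr_comp_isGreatest (incl h) u).1)

theorem incl_comp_eq {e : LCat G} {a f : G.Obj} (h : a ≤ f) (u : ⟨f⟩ ⟶ e) (v : ⟨a⟩ ⟶ e)
    (hle : arr v ≤ arr u) : incl h ≫ u = v :=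
  hom_ext (eq_of_le_of_dom (arr_incl_comp_le h u) hle (by rw [dom_arr, dom_arr]))

theorem arr_comp_of_ran_eq {a f e : LCat G} (v : a ⟶ f) (u : f ⟶ e)
    (h : G.ran (arr v) = f.obj) :
    arr (v ≫ u) = G.comp (arr u) (arr v) ((dom_arr u).trans h.symm) :=
  (arr_comp_isGreatest v u).unique (comp_isGreatest _ _ _)

end LCat

namespace EtaleSet

variable (X : EtaleSet G)

/-- The element below `x` lying over `e`. -/
noncomputable def lift (x : X.carrier) (e : G.Obj) (h : e ≤ X.p x) : X.carrier :=
  (X.fibration.2 x e h).choose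

theorem lift_le (x : X.carrier) (e : G.Obj) (h : e ≤ X.p x) : X.lift x e h ≤ x :=
  (X.fibration.2 x e h).choose_spec.1.1

theorem p_lift (x : X.carrier) (e : G.Obj) (h : e ≤ X.p x) : X.p (X.lift x e h) = e :=
  (X.fibration.2 x e h).choose_spec.1.2

theorem eq_lift {x z : X.carrier} {e : G.Obj} (h : e ≤ X.p x) (hz : z ≤ x) (hz' : X.p z = e) :
    z = X.lift x e h :=
  X.fibration.eq_of_le hz (X.lift_le x e h) (hz'.trans (X.p_lift x e h).symm)

/-- The action of an arrow `g` on an element lying over an object above `ran g`: restriction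
followed by the action of `G`. -/
noncomputable def smul (x : X.carrier) (g : G.Arr) (h : G.ran g ≤ X.p x) : X.carrier :=
  X.act (X.lift x (G.ran g) h) g (X.p_lift _ _ _)

theorem p_smul (x : X.carrier) (g : G.Arr) (h : G.ran g ≤ X.p x) :
    X.p (X.smul x g h) = G.dom g := X.p_act _ _ _

theorem act_congr {x y : X.carrier} {g k : G.Arr} (hx : x = y) (hg : g = k)
    (w : X.p x = G.ran g) : X.act x g w = X.act y k (by rw [← hx, w, hg]) := by
  subst hx hg; rfl

theorem smul_congr (x : X.carrier) {g k : G.Arr} (hg : g = k) (h : G.ran g ≤ X.p x) :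
    X.smul x g h = X.smul x k (hg ▸ h) := by
  subst hg; rfl

theorem smul_eq_act (x : X.carrier) (g : G.Arr) (h : X.p x = G.ran g) :
    X.smul x g h.ge = X.act x g h :=
  X.act_congr (X.eq_lift h.ge le_rfl h).symm rfl _

theorem smul_mono {x y : X.carrier} {g k : G.Arr} (hx : x ≤ y) (hg : g ≤ k)
    (h : G.ran g ≤ X.p x) (h' : G.ran k ≤ X.p y) : X.smul x g h ≤ X.smul y k h' := by
  refine X.act_mono _ _ _ _ _ _ ?_ hg
  refine X.fibration.le_of_le ((X.lift_le _ _ _).trans hx) (X.lift_le _ _ _) ?_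
  rw [p_lift, p_lift]
  exact G.ran_mono hg

theorem act_one' (x : X.carrier) (e : G.Obj) (h : X.p x = G.ran (G.one e)) :
    X.act x (G.one e) h = x := by
  obtain rfl : X.p x = e := h.trans (G.ran_one e)
  exact X.act_one x

theorem smul_one (x : X.carrier) (e : G.Obj) (h : G.ran (G.one e) ≤ X.p x) :
    X.smul x (G.one e) h = X.lift x e ((G.ran_one e).symm.trans_le h) := by
  rw [smul, act_one']
  exact X.eq_lift _ (X.lift_le _ _ _) ((X.p_lift _ _ _).trans (G.ran_one e))

theorem smul_comp {a f e : LCat G} (v : a ⟶ f) (u : f ⟶ e) (x : X.carrier)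
    (h : G.ran (LCat.arr (v ≫ u)) ≤ X.p x) (hu : G.ran (LCat.arr u) ≤ X.p x)
    (hv : G.ran (LCat.arr v) ≤ X.p (X.smul x (LCat.arr u) hu)) :
    X.smul x (LCat.arr (v ≫ u)) h = X.smul (X.smul x (LCat.arr u) hu) (LCat.arr v) hv := by
  obtain ⟨⟨g, k, w, hg, hk, hgk⟩, -⟩ := LCat.arr_comp_isGreatest v u
  have hkd : G.dom k = G.dom (LCat.arr v) := by
    rw [← G.dom_comp g k w, hgk, LCat.dom_arr, LCat.dom_arr]
  obtain rfl : k = LCat.arr v := eq_of_le_of_dom hk le_rfl hkd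
  have hgx : G.ran g ≤ X.p x := (G.ran_mono hg).trans hu
  rw [X.smul_congr x hgk.symm]
  refine (X.act_congr (X.eq_lift hgx (X.lift_le _ _ _)
    ((X.p_lift _ _ _).trans (G.ran_comp _ _ _))) rfl _).trans ?_
  refine (X.act_comp _ _ _ (X.p_lift x _ hgx) w).trans (X.act_congr ?_ rfl _)
  exact X.eq_lift _ (X.smul_mono le_rfl hg _ _) ((X.p_act _ _ _).trans w)

/-- The presheaf on `L(G)` of sections of an étale `G`-set. -/
noncomputable def presheaf : (LCat G)ᵒᵖ ⥤ Type u where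
  obj e := {x : X.carrier // X.p x = (unop e).obj}
  map {e f} i := TypeCat.ofHom fun x => ⟨X.smul x.1 (LCat.arr i.unop)
    ((LCat.ran_arr_le i.unop).trans_eq x.2.symm), (X.p_smul _ _ _).trans (LCat.dom_arr i.unop)⟩
  map_id e := by
    ext x
    exact (X.smul_one x.1 _ _).trans (X.eq_lift x.2.ge le_rfl x.2).symm
  map_comp i j := by
    ext x
    exact X.smul_comp j.unop i.unop x.1 _ _ _

variable {X} {Y : EtaleSet G}

theorem hom_ext {φ ψ : X ⟶ Y} (h : ∀ x, Hom.toFun φ x = Hom.toFun ψ x) : φ = ψ :=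
  Hom.ext (funext h)

theorem map_smul (φ : X ⟶ Y) (x : X.carrier) (g : G.Arr) (h : G.ran g ≤ X.p x) :
    Hom.toFun φ (X.smul x g h) = Y.smul (Hom.toFun φ x) g (h.trans_eq (Hom.p_map φ x).symm) :=
  (Hom.map_act φ _ _ _).trans (Y.act_congr (Y.eq_lift _ (Hom.mono φ (X.lift_le _ _ _))
    ((Hom.p_map φ _).trans (X.p_lift _ _ _))) rfl _)

variable (G) in
/-- The functor from étale `G`-sets to presheaves on `L(G)`. -/
noncomputable def toPresheaf : EtaleSet G ⥤ (LCat G)ᵒᵖ ⥤ Type u where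
  obj X := X.presheaf
  map φ :=
    { app := fun _ => TypeCat.ofHom fun x =>
        ⟨Hom.toFun φ x.1, (Hom.p_map φ x.1).trans x.2⟩
      naturality := fun _ _ i => by
        ext x
        apply Subtype.ext
        exact map_smul φ x.1 _ _ }

instance : (toPresheaf G).Faithful where
  map_injective {X Y} _ _ h := hom_ext fun x =>
    congrArg (fun α : X.presheaf ⟶ Y.presheaf => (α.app (op ⟨X.p x⟩) ⟨x, rfl⟩).1) h

/-- The function underlying a morphism of presheaves of sections. -/
def ofPresheafHom (α : X.presheaf ⟶ Y.presheaf) (x : X.carrier) : Y.carrier :=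
  (α.app (op ⟨X.p x⟩) ⟨x, rfl⟩).1

theorem ofPresheafHom_eq (α : X.presheaf ⟶ Y.presheaf) {e : (LCat G)ᵒᵖ}
    (x : X.presheaf.obj e) : ofPresheafHom α x.1 = (α.app e x).1 := by
  have : ∀ (y : X.carrier) (f : G.Obj) (h : X.p y = f),
      ofPresheafHom α y = (α.app (op ⟨f⟩) ⟨y, h⟩).1 := by
    rintro y _ rfl
    rfl
  exact this _ _ x.2

theorem p_ofPresheafHom (α : X.presheaf ⟶ Y.presheaf) (x : X.carrier) :
    Y.p (ofPresheafHom α x) = X.p x :=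
  (α.app (op ⟨X.p x⟩) ⟨x, rfl⟩).2

theorem ofPresheafHom_smul (α : X.presheaf ⟶ Y.presheaf) (x : X.carrier) (g : G.Arr)
    (h : G.ran g ≤ X.p x) : ofPresheafHom α (X.smul x g h) =
      Y.smul (ofPresheafHom α x) g (h.trans_eq (p_ofPresheafHom α x).symm) := by
  let s : X.presheaf.obj (op ⟨X.p x⟩) := ⟨x, rfl⟩
  have := ofPresheafHom_eq α (X.presheaf.map (LCat.ofArr g h).op s)
  rw [NatTrans.naturality_apply] at this
  exact this

/-- The morphism of étale `G`-sets inducing a morphism of presheaves of sections. -/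
def homOfPresheafHom (α : X.presheaf ⟶ Y.presheaf) : Hom G X Y where
  toFun := ofPresheafHom α
  mono x y h := by
    have hp : X.p x ≤ X.p y := X.fibration.1 h
    have h1 := ofPresheafHom_smul α y (G.one (X.p x)) ((G.ran_one _).trans_le hp)
    rw [smul_one, smul_one, ← X.eq_lift hp h rfl] at h1
    exact h1.trans_le (Y.lift_le _ _ _)
  p_map := p_ofPresheafHom α
  map_act x g w := by rw [← X.smul_eq_act, ofPresheafHom_smul, ← Y.smul_eq_act]

instance : (toPresheaf G).Full where
  map_surjective {X Y} α := ⟨homOfPresheafHom α, by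
    ext e x
    exact Subtype.ext (ofPresheafHom_eq α x)⟩

section

variable (P : (LCat G)ᵒᵖ ⥤ Type u)

/-- The set of germs of a presheaf on `L(G)`. -/
def Germ : Type u := Σ e : G.Obj, P.obj (op ⟨e⟩)

variable {P}

theorem Germ.mk_map_eq {e : LCat G} {f f' : G.Obj} (u : ⟨f⟩ ⟶ e) (u' : ⟨f'⟩ ⟶ e)
    (h : LCat.arr u = LCat.arr u') (s : P.obj (op e)) :
    (⟨f, P.map u.op s⟩ : Germ P) = ⟨f', P.map u'.op s⟩ := by
  obtain rfl : f = f' := (LCat.dom_arr u).symm.trans ((congrArg G.dom h).trans (LCat.dom_arr u'))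
  rw [LCat.hom_ext h]

theorem Germ.map_incl_trans {e f k : G.Obj} (h : e ≤ f) (h' : f ≤ k) (s : P.obj (op ⟨k⟩)) :
    P.map (LCat.incl (h.trans h')).op s =
      P.map (LCat.incl h).op (P.map (LCat.incl h').op s) := by
  have : LCat.incl (h.trans h') = LCat.incl h ≫ LCat.incl h' :=
    LCat.hom_ext (LCat.arr_comp_incl (LCat.incl h) h').symm
  rw [this, op_comp, P.map_comp]
  rfl

instance : PartialOrder (Germ P) where
  le x y := ∃ h : x.1 ≤ y.1, P.map (LCat.incl h).op y.2 = x.2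
  le_refl x := ⟨le_rfl, by rw [LCat.incl_refl, op_id, P.map_id]; rfl⟩
  le_trans x y z := by
    rintro ⟨h, h1⟩ ⟨h', h2⟩
    exact ⟨h.trans h', by rw [Germ.map_incl_trans h h', h2, h1]⟩
  le_antisymm := by
    rintro ⟨e, s⟩ ⟨f, t⟩ ⟨h, h1⟩ ⟨h', h2⟩
    obtain rfl : e = f := le_antisymm h h'
    have h1 : P.map (LCat.incl (le_refl e)).op t = s := h1
    rw [LCat.incl_refl, op_id, P.map_id] at h1
    obtain rfl : t = s := h1
    rfl

theorem Germ.isDiscreteFibration : IsDiscreteFibration (fun x : Germ P => x.1) := by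
  refine ⟨fun _ _ h => h.1, ?_⟩
  rintro ⟨e, s⟩ f h
  refine ⟨⟨f, P.map (LCat.incl h).op s⟩, ⟨⟨h, rfl⟩, rfl⟩, ?_⟩
  rintro ⟨f, t⟩ ⟨⟨_, h1⟩, rfl⟩
  exact congrArg (Sigma.mk f) h1.symm

variable (P)

/-- The étale `G`-set of germs of a presheaf on `L(G)`. -/
noncomputable def ofPresheaf : EtaleSet G where
  carrier := Germ P
  p x := x.1
  fibration := Germ.isDiscreteFibration
  act x g w := ⟨G.dom g, P.map (LCat.ofArr g w.ge).op x.2⟩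
  p_act _ _ _ := rfl
  act_one x := by
    refine (Germ.mk_map_eq (LCat.ofArr (G.one x.1) (G.ran_one _).le) (𝟙 _) rfl x.2).trans ?_
    rw [op_id, P.map_id]
    rfl
  act_comp := by
    rintro ⟨e, s⟩ g h w w'
    have w : e = G.ran g := w
    subst w
    refine (Germ.mk_map_eq (LCat.ofArr (G.comp g h w') (G.ran_comp _ _ _).le)
      (LCat.ofArr h w'.ge ≫ LCat.ofArr g le_rfl)
      (LCat.arr_comp_of_ran_eq (LCat.ofArr h w'.ge) (LCat.ofArr g le_rfl) w'.symm).symm s).trans ?_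
    rw [op_comp, P.map_comp]
    rfl
  act_mono := by
    rintro ⟨e, s⟩ ⟨f, t⟩ g h w w' ⟨hef, hst⟩ hgh
    refine ⟨G.dom_mono hgh, ?_⟩
    dsimp only at hst ⊢
    have hcomp := LCat.incl_comp_eq (G.dom_mono hgh) (LCat.ofArr h w'.ge)
      (LCat.ofArr g w.ge ≫ LCat.incl hef) ((LCat.arr_comp_incl _ _).trans_le hgh)
    have := congrArg (fun u => P.map (Quiver.Hom.op u) t) hcomp
    simpa only [op_comp, P.map_comp, comp_apply, hst] using this

theorem ofPresheaf_smul {e f : LCat G} (s : P.obj (op e)) (u : f ⟶ e) :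
    (ofPresheaf P).smul (⟨e.obj, s⟩ : Germ P) (LCat.arr u) (LCat.ran_arr_le u) =
      (⟨f.obj, P.map u.op s⟩ : Germ P) := by
  let z : Germ P := ⟨G.ran (LCat.arr u), P.map (LCat.incl (LCat.ran_arr_le u)).op s⟩
  refine ((ofPresheaf P).act_congr ((ofPresheaf P).eq_lift (z := z) _
    ⟨LCat.ran_arr_le u, rfl⟩ rfl).symm rfl _).trans ?_
  refine Eq.trans ?_ (Germ.mk_map_eq (LCat.ofArr (LCat.arr u) le_rfl ≫
    LCat.incl (LCat.ran_arr_le u)) u (LCat.arr_comp_incl _ _) s)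
  rw [op_comp, P.map_comp]
  rfl

/-- A presheaf is isomorphic to the presheaf of sections of its étale `G`-set of germs. -/
noncomputable def presheafOfPresheafIso : P ≅ (ofPresheaf P).presheaf :=
  NatIso.ofComponents
    (fun e => Equiv.toIso
      { toFun := fun s => ⟨(⟨(unop e).obj, s⟩ : Germ P), rfl⟩
        invFun := fun x => P.map (LCat.incl (G := G) x.2.ge).op x.1.2
        left_inv := fun s => by
          change P.map (𝟙 _) s = s
          rw [P.map_id]
          rfl
        right_inv := by
          rintro ⟨⟨f, s⟩, h⟩
          obtain rfl : f = (unop e).obj := h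
          apply Subtype.ext
          change (⟨_, P.map (𝟙 _) s⟩ : Germ P) = ⟨_, s⟩
          rw [P.map_id]
          rfl })
    (fun {e f} i => by
      ext s
      apply Subtype.ext
      exact (ofPresheaf_smul P (e := unop e) (f := unop f) s i.unop).symm)

end

instance : (toPresheaf G).EssSurj where
  mem_essImage P := ⟨ofPresheaf P, ⟨(presheafOfPresheafIso P).symm⟩⟩

instance : (toPresheaf G).IsEquivalence where

end EtaleSet
end OrderedGroupoid

theorem OrderedGroupoid.nonempty_equivalence_etaleSet_iff {G H : OrderedGroupoid.{u}}
    [G.PrincipallyInductive] [H.PrincipallyInductive] :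
    Nonempty (OrderedGroupoid.EtaleSet G ≌ OrderedGroupoid.EtaleSet H) ↔
      HaveMoritaContext (OrderedGroupoid.LCat G) (OrderedGroupoid.LCat H) := by
  constructor
  · rintro ⟨E⟩
    exact .of_presheaf_equivalence (fun _ => LCat.eq_id_of_idem) (fun _ => LCat.eq_id_of_idem)
      (((EtaleSet.toPresheaf G).asEquivalence.symm.trans E).trans
        (EtaleSet.toPresheaf H).asEquivalence)
  · intro h
    obtain ⟨E⟩ := h.nonempty_equivalence
    exact ⟨((EtaleSet.toPresheaf G).asEquivalence.trans E.op.congrLeft).trans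
      (EtaleSet.toPresheaf H).asEquivalence.symm⟩

theorem mainTheorem8 (G H : OrderedGroupoid.{u}) [G.PrincipallyInductive]
    [H.PrincipallyInductive] :
    List.TFAE [
      Nonempty (OrderedGroupoid.EtaleSet G ≌ OrderedGroupoid.EtaleSet H),
      HaveMoritaContext (OrderedGroupoid.LCat G) (OrderedGroupoid.LCat H),
      HaveMoritaContext (OrderedGroupoid.CCat G) (OrderedGroupoid.CCat H)] := by
  tfae_have 1 ↔ 2 := OrderedGroupoid.nonempty_equivalence_etaleSet_iff
  tfae_have 2 ↔ 3 := OrderedGroupoid.haveMoritaContext_lCat_iff_cCat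
  tfae_finish
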